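/- Let $(\mathsf Y_i)_{i\ge 1}$ and $(\mathsf Z_i)_{i\ge 1}$ be real-valued stochastic processes on a common probability space (arbitrary, possibly dependent, with arbitrary distributions) and let $\lambda\in[0,1]$. For $n\in\mathbb N$ put $\ell=\lfloor\lambda n\rfloor$ and let $$\mathsf x=[\mathsf Y_1\ \cdots\ \mathsf Y_{n-\ell}\ \ \mathsf Z_1\ \cdots\ \mathsf Z_\ell]^{\mathsf T}\in\mathbb R^n$$ be the concatenated source vector. For a nonempty bounded set $S\subseteq\mathbb R^n$ let $N_S(\delta)$ be the least number of open Euclidean balls of radius $\delta$, with centers in $\mathbb R^n$, that cover $S$, and define the lower Minkowski dimension $$\underline{\dim}_{\mathrm B}(S)=\liminf_{\delta\to0^+}\frac{\log N_S(\delta)}{\log(1/\delta)}.$$ For $\varepsilon>0$ define the lower Minkowski dimension compression rate $$\underline R_{\mathrm B}(\varepsilon)=\limsup_{n\to\infty}\ \inf\Big\{\tfrac1n\,\underline{\dim}_{\mathrm B}(S)\ :\ S\subseteq\mathbb R^n \text{ nonempty, bounded and Borel},\ \mathbb P[\mathsf x\in S]\ge 1-\varepsilon\Big\}.$$ **Theorem.**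 Let $\varepsilon>0$ and let $R\in\mathbb R$ satisfy $R>\underline R_{\mathrm B}(\varepsilon)$. Then there is an $N\in\mathbb N$, which does not depend on the matrices $A$ and $B$ below, such that for all $n\ge N$, with $k=\lfloor Rn\rfloor$, the following holds whenever $k\ge\ell$. For every full-rank matrix $B\in\mathbb R^{k\times\ell}$ (that is, $\operatorname{rank}B=\ell$) and for Lebesgue-almost every matrix $A\in\mathbb R^{k\times(n-\ell)}$ (the exceptional null set may depend on $B$), there exists a Borel measurable map (separator) $g:\mathbb R^k\to\mathbb R^{n-\ell}\times\mathbb R^{\ell}$ such that $$\mathbb P\big[g([A\ \,B]\,\mathsf x)\ne\mathsf x\big]\le\varepsilon .$$ -/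

import Mathlib

open Filter MeasureTheory
open scoped Topology

noncomputable section

/-- The covering number `N_S(δ)`: the least number of open balls of radius `δ`, with arbitrary
centers in the ambient space, that cover `S`. -/
def coveringNumber {E : Type*} [PseudoMetricSpace E] (S : Set E) (δ : ℝ) : ℕ :=
  sInf {m : ℕ | ∃ c : Fin m → E, S ⊆ ⋃ i, Metric.ball (c i) δ}

/-- The lower Minkowski (box-counting) dimension
`liminf_{δ → 0+} log N_S(δ) / log (1/δ)`, with the liminf taken in the extended reals.
It is used for nonempty bounded sets of a Euclidean space only. -/
def lowerMinkowskiDim {E : Type*} [PseudoMetricSpace E] (S : Set E) : EReal :=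
  liminf (fun δ : ℝ => ((Real.log (coveringNumber S δ) / Real.log (1 / δ) : ℝ) : EReal))
    (𝓝[>] (0 : ℝ))

/-- The length `ℓ = ⌊λ n⌋` of the second block of the source vector of dimension `n`. -/
def blockLen (lam : ℝ) (n : ℕ) : ℕ := ⌊lam * n⌋₊

/-- The index set of a vector of dimension `n` that consists of a block of length `n - ℓ`
followed by a block of length `ℓ = ⌊λ n⌋`. -/
abbrev BlockIdx (lam : ℝ) (n : ℕ) : Type := Fin (n - blockLen lam n) ⊕ Fin (blockLen lam n)

/-- The concatenated source vector `[Y₁ … Y_{n-ℓ} Z₁ … Z_ℓ]ᵀ` of dimension `n`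
(the processes are indexed from `0` here). -/
def sourceVector {Ω : Type*} (Y Z : ℕ → Ω → ℝ) (lam : ℝ) (n : ℕ) (ω : Ω) :
    EuclideanSpace ℝ (BlockIdx lam n) :=
  WithLp.toLp 2 (Sum.elim (fun i => Y i ω) (fun i => Z i ω))

/-- The quantity `a_n(ε)`: the infimum of `dim_B(S) / n` (lower Minkowski dimension) over the
nonempty bounded Borel sets `S` in dimension `n` that contain the source vector with
probability at least `1 - ε`. -/
def lowerDimRatio {Ω : Type*} [MeasurableSpace Ω] (P : Measure Ω) (Y Z : ℕ → Ω → ℝ)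
    (lam ε : ℝ) (n : ℕ) : EReal :=
  sInf {a : EReal | ∃ S : Set (EuclideanSpace ℝ (BlockIdx lam n)),
    S.Nonempty ∧ Bornology.IsBounded S ∧ MeasurableSet S ∧
    1 - ε ≤ P.real {ω | sourceVector Y Z lam n ω ∈ S} ∧
    a = lowerMinkowskiDim S / (n : EReal)}

/-- The lower Minkowski dimension compression rate `limsup_{n → ∞} a_n(ε)`. -/
def lowerCompressionRate {Ω : Type*} [MeasurableSpace Ω] (P : Measure Ω) (Y Z : ℕ → Ω → ℝ)
    (lam ε : ℝ) : EReal :=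
  limsup (fun n : ℕ => lowerDimRatio P Y Z lam ε n) atTop

/-- The noiseless linear measurement `[A B] x = A y + B z` of `x = [y; z]`. -/
def measurement {lam : ℝ} {n k : ℕ} (A : Fin k → Fin (n - blockLen lam n) → ℝ)
    (B : Matrix (Fin k) (Fin (blockLen lam n)) ℝ) (x : EuclideanSpace ℝ (BlockIdx lam n)) :
    EuclideanSpace ℝ (Fin k) :=
  WithLp.toLp 2 (Matrix.mulVec (Matrix.fromCols (Matrix.of A) B) x.ofLp)

end

/-! For large `n` some bounded `S` of lower Minkowski dimension below `k` carries the source with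
probability at least `1 - ε`. Let `K` be its closure and fix `x`. For `x'` in a ball of radius `δ`,
with a first block bounded away from that of `x`, a collision of measurements confines each of the
`k` rows of a bounded `A` to a slab of volume `O(δ)`. Summing over `δ ^ (-s)` balls with `s < k`
gives `O(δ ^ (k - s))`, which tends to `0` along suitable `δ` (`volume_collisionMatrices_eq_zero`).
As `B` is injective, every collision of distinct points is seen in the first block. Fubini then
yields, for almost every `A`, almost sure unique decodability within `K`, and Lusin–Souslin makes
the decoder Borel. -/

theorem volume_slab_le {ι : Type*} [Fintype ι] [DecidableEq ι] (v : ι → ℝ) (j : ι) (hv : v j ≠ 0)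
    (r b η : ℝ) :
    volume {a : ι → ℝ | (∀ i, |a i| ≤ r) ∧ |∑ i, a i * v i + b| ≤ η} ≤
      ENNReal.ofReal |(v j)⁻¹| *
        (ENNReal.ofReal (2 * η) * ENNReal.ofReal (2 * r) ^ (Fintype.card ι - 1)) := by
  have hdet : ((1 : Matrix ι ι ℝ).updateCol j v).det = v j := by
    rw [← Matrix.cramer_apply, Matrix.cramer_one]; rfl
  -- `T` replaces the coordinate `j` of `a` by `∑ i, a i * v i`. Its determinant is `v j`, and it
  -- maps the slab into a box whose side `j` has length `2 * η`.
  set T : (ι → ℝ) →ₗ[ℝ] (ι → ℝ) := Matrix.toLin' ((1 : Matrix ι ι ℝ).updateRow j v) with hT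
  have hdetT : LinearMap.det T = v j := by
    rw [hT, LinearMap.det_toLin', ← Matrix.det_transpose, ← Matrix.updateCol_transpose,
      Matrix.transpose_one, hdet]
  have hTj (a : ι → ℝ) : T a j = ∑ i, a i * v i := by
    simp [hT, Matrix.mulVec, dotProduct, mul_comm]
  have hTi (a : ι → ℝ) (i : ι) (hi : i ≠ j) : T a i = a i := by
    simp [hT, Matrix.mulVec, dotProduct, Matrix.updateRow_ne hi, Matrix.one_apply]
  have hsub : {a : ι → ℝ | (∀ i, |a i| ≤ r) ∧ |∑ i, a i * v i + b| ≤ η} ⊆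
      T ⁻¹' Set.pi Set.univ
        (Function.update (fun _ => Set.Icc (-r) r) j (Set.Icc (-b - η) (-b + η))) := by
    rintro a ⟨ha, hab⟩ i -
    by_cases hi : i = j
    · subst hi
      rw [Function.update_self, hTj]
      rw [abs_le] at hab
      constructor <;> linarith
    · rw [Function.update_of_ne hi, hTi a i hi]
      exact abs_le.1 (ha i)
  refine (measure_mono hsub).trans ?_
  rw [Measure.addHaar_preimage_linearMap _ (by rwa [hdetT]), hdetT, volume_pi_pi]
  refine mul_le_mul_right (le_of_eq ?_) _
  rw [← Finset.mul_prod_erase _ _ (Finset.mem_univ j), Function.update_self,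
    Finset.prod_congr rfl (g := fun _ => ENNReal.ofReal (2 * r))]
  · rw [Finset.prod_const, Finset.card_erase_of_mem (Finset.mem_univ j), Finset.card_univ,
      Real.volume_Icc]
    congr 2; ring
  · intro i hi
    rw [Function.update_of_ne (Finset.ne_of_mem_erase hi), Real.volume_Icc]
    congr 1; ring

/-! ### Covers at small scales -/

/-- A set `K` is covered, for arbitrarily small `δ > 0`, by at most `δ ^ (-s)` closed balls of
radius `δ`. -/
def FrequentlyCoveredBy {E : Type*} [PseudoMetricSpace E] (K : Set E) (s : ℝ) : Prop :=
  ∃ᶠ δ in 𝓝[>] (0 : ℝ), ∃ (m : ℕ) (c : Fin m → E),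
    K ⊆ ⋃ i, Metric.closedBall (c i) δ ∧ (m : ℝ) ≤ δ ^ (-s)

/-- A finite union of closed balls is closed, so a cover of `K` also covers its closure. This allows
passing to a compact set. -/
theorem FrequentlyCoveredBy.closure {E : Type*} [PseudoMetricSpace E] {K : Set E} {s : ℝ}
    (h : FrequentlyCoveredBy K s) : FrequentlyCoveredBy (closure K) s :=
  h.mono fun _ ⟨m, c, hc, hm⟩ => ⟨m, c,
    closure_minimal hc (isClosed_iUnion_of_finite fun _ => Metric.isClosed_closedBall), hm⟩

theorem frequentlyCoveredBy_of_lowerMinkowskiDim_lt {E : Type*} [PseudoMetricSpace E] {S : Set E}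
    (hne : S.Nonempty) (hS : TotallyBounded S) {s : ℝ}
    (h : lowerMinkowskiDim S < (s : EReal)) : FrequentlyCoveredBy S s := by
  have hfreq := frequently_lt_of_liminf_lt (by isBoundedDefault) h
  refine (hfreq.and_eventually (Ioo_mem_nhdsGT one_pos)).mono ?_
  rintro δ ⟨hlt, hδ0, hδ1⟩
  -- A finite cover must exist, since otherwise `sInf` would take its default value `0`.
  have hset : {m : ℕ | ∃ c : Fin m → E, S ⊆ ⋃ i, Metric.ball (c i) δ}.Nonempty := by
    obtain ⟨t, ht, hcov⟩ := Metric.totallyBounded_iff.1 hS δ hδ0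
    have := ht.fintype
    refine ⟨Fintype.card t, fun i => ((Fintype.equivFin t).symm i : E), hcov.trans ?_⟩
    refine Set.iUnion₂_subset fun y hy => ?_
    refine Set.subset_iUnion_of_subset (Fintype.equivFin t ⟨y, hy⟩) ?_
    simp
  obtain ⟨c, hc⟩ := Nat.sInf_mem hset
  refine ⟨coveringNumber S δ, c, hc.trans (Set.iUnion_mono fun i => Metric.ball_subset_closedBall),
    ?_⟩
  have hpos : 0 < coveringNumber S δ := by
    obtain ⟨x, hx⟩ := hne
    obtain ⟨i, -⟩ := Set.mem_iUnion.1 (hc hx)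
    exact i.pos
  have hlog : 0 < Real.log (1 / δ) := Real.log_pos (by rw [lt_div_iff₀ hδ0]; linarith)
  rw [EReal.coe_lt_coe_iff, div_lt_iff₀ hlog] at hlt
  rw [← Real.log_le_log_iff (by exact_mod_cast hpos) (Real.rpow_pos_of_pos hδ0 _),
    Real.log_rpow hδ0]
  rw [one_div, Real.log_inv] at hlt
  linarith

/-! ### Null sets of colliding matrices -/

theorem measurement_apply {lam : ℝ} {n k : ℕ} (A : Fin k → Fin (n - blockLen lam n) → ℝ)
    (B : Matrix (Fin k) (Fin (blockLen lam n)) ℝ) (x : EuclideanSpace ℝ (BlockIdx lam n))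
    (i : Fin k) :
    measurement A B x i = ∑ j, A i j * x (Sum.inl j) + ∑ l, B i l * x (Sum.inr l) := by
  simp [measurement, Matrix.mulVec, dotProduct]

theorem continuous_measurement_uncurry {lam : ℝ} {n k : ℕ}
    (B : Matrix (Fin k) (Fin (blockLen lam n)) ℝ) :
    Continuous fun q : (Fin k → Fin (n - blockLen lam n) → ℝ) ×
      EuclideanSpace ℝ (BlockIdx lam n) => measurement q.1 B q.2 := by
  refine (PiLp.continuous_toLp 2 _).comp (continuous_pi fun i => ?_)
  change Continuous fun q : (Fin k → Fin (n - blockLen lam n) → ℝ) ×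
    EuclideanSpace ℝ (BlockIdx lam n) => measurement q.1 B q.2 i
  simp only [measurement_apply]
  fun_prop

/-- The matrices `A` bounded by `r` for which a point of `K` other than `x`, at distance at least
`d` from `x` in the coordinate `j` of the first block, has the same measurement as `x`. -/
def collisionMatrices {lam : ℝ} {n k : ℕ} (B : Matrix (Fin k) (Fin (blockLen lam n)) ℝ)
    (K : Set (EuclideanSpace ℝ (BlockIdx lam n))) (x : EuclideanSpace ℝ (BlockIdx lam n))
    (r d : ℝ) (j : Fin (n - blockLen lam n)) : Set (Fin k → Fin (n - blockLen lam n) → ℝ) :=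
  {A | (∀ i l, |A i l| ≤ r) ∧ ∃ x' ∈ K, d ≤ |x' (Sum.inl j) - x (Sum.inl j)| ∧
    measurement A B x' = measurement A B x}

theorem abs_measurement_sub_le {lam : ℝ} {n k : ℕ} {A : Fin k → Fin (n - blockLen lam n) → ℝ}
    {B : Matrix (Fin k) (Fin (blockLen lam n)) ℝ} {r : ℝ} (hA : ∀ i l, |A i l| ≤ r)
    (hB : ∀ i l, |B i l| ≤ r) (x y : EuclideanSpace ℝ (BlockIdx lam n)) (i : Fin k) :
    |measurement A B x i - measurement A B y i| ≤ Fintype.card (BlockIdx lam n) * (r * dist x y) := by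
  have hcoord (l : BlockIdx lam n) : |x l - y l| ≤ dist x y := by
    rw [← Real.dist_eq]
    exact PiLp.dist_apply_le x y l
  have hr (c : ℝ) (hc : |c| ≤ r) (l : BlockIdx lam n) : |c * (x l - y l)| ≤ r * dist x y := by
    rw [abs_mul]
    exact mul_le_mul hc (hcoord l) (abs_nonneg _) ((abs_nonneg _).trans hc)
  have heq : measurement A B x i - measurement A B y i =
      ∑ l : BlockIdx lam n, Sum.elim (A i) (B i) l * (x l - y l) := by
    simp only [measurement_apply, Fintype.sum_sum_type, Sum.elim_inl, Sum.elim_inr, mul_sub,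
      Finset.sum_sub_distrib]
  rw [heq]
  refine (Finset.abs_sum_le_sum_abs _ _).trans ?_
  refine (Finset.sum_le_card_nsmul _ _ (r * dist x y) ?_).trans_eq (by simp)
  rintro (l | l) -
  · exact hr _ (hA i l) _
  · exact hr _ (hB i l) _

theorem volume_collisionMatrices_closedBall_le {lam : ℝ} {n k : ℕ}
    {B : Matrix (Fin k) (Fin (blockLen lam n)) ℝ} {r : ℝ} (hB : ∀ i l, |B i l| ≤ r) (hr : 0 ≤ r)
    {d : ℝ} (hd : 0 < d) (j : Fin (n - blockLen lam n))
    (K : Set (EuclideanSpace ℝ (BlockIdx lam n))) (c x : EuclideanSpace ℝ (BlockIdx lam n))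
    (δ : ℝ) :
    volume (collisionMatrices B (K ∩ Metric.closedBall c δ) x r d j) ≤
      (ENNReal.ofReal d⁻¹ * (ENNReal.ofReal (2 * (Fintype.card (BlockIdx lam n) * (r * (2 * δ)))) *
        ENNReal.ofReal (2 * r) ^ (n - blockLen lam n - 1))) ^ k := by
  -- One witness `w` serves for all `A`: every other `x'` in the ball is within `2 * δ` of it, so
  -- the slabs have a fixed normal `v` with `d ≤ |v j|`.
  rcases (collisionMatrices B (K ∩ Metric.closedBall c δ) x r d j).eq_empty_or_nonempty with
    h0 | ⟨-, -, w, ⟨-, hwc⟩, hwd, -⟩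
  · simp [h0]
  set η : ℝ := Fintype.card (BlockIdx lam n) * (r * (2 * δ)) with hη
  set v : Fin (n - blockLen lam n) → ℝ := fun l => w (Sum.inl l) - x (Sum.inl l) with hv
  have hvj : d ≤ |v j| := hwd
  have hvj0 : v j ≠ 0 := abs_pos.1 (hd.trans_le hvj)
  have hsub : collisionMatrices B (K ∩ Metric.closedBall c δ) x r d j ⊆
      Set.pi Set.univ fun i => {a | (∀ l, |a l| ≤ r) ∧
        |∑ l, a l * v l + ∑ l, B i l * (w (Sum.inr l) - x (Sum.inr l))| ≤ η} := by
    rintro A ⟨hA, x', ⟨-, hx'c⟩, -, heq⟩ i -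
    refine ⟨hA i, ?_⟩
    have h1 := abs_measurement_sub_le hA hB w x' i
    have h2 : dist w x' ≤ 2 * δ := by
      have := dist_triangle_right w x' c
      rw [Metric.mem_closedBall] at hwc hx'c
      linarith
    have h3 : ∑ l, A i l * v l + ∑ l, B i l * (w (Sum.inr l) - x (Sum.inr l)) =
        measurement A B w i - measurement A B x' i := by
      rw [heq]
      simp only [measurement_apply, hv, mul_sub, Finset.sum_sub_distrib]
      ring
    rw [h3]
    refine h1.trans ?_
    rw [hη]
    gcongr
  refine (measure_mono hsub).trans ?_
  rw [volume_pi_pi]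
  refine (Finset.prod_le_pow_card _ _ _ fun i _ => ?_).trans_eq
    (by rw [Finset.card_univ, Fintype.card_fin])
  refine (volume_slab_le v j hvj0 r _ η).trans ?_
  rw [Fintype.card_fin]
  gcongr
  rw [abs_inv]
  gcongr

theorem volume_collisionMatrices_eq_zero {lam : ℝ} {n k : ℕ}
    {B : Matrix (Fin k) (Fin (blockLen lam n)) ℝ} {r : ℝ} (hB : ∀ i l, |B i l| ≤ r) (hr : 0 ≤ r)
    {d : ℝ} (hd : 0 < d) (j : Fin (n - blockLen lam n))
    {K : Set (EuclideanSpace ℝ (BlockIdx lam n))} {s : ℝ} (hK : FrequentlyCoveredBy K s)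
    (hs : s < k) (x : EuclideanSpace ℝ (BlockIdx lam n)) :
    volume (collisionMatrices B K x r d j) = 0 := by
  set C : ENNReal := (ENNReal.ofReal d⁻¹ *
    (ENNReal.ofReal (2 * (Fintype.card (BlockIdx lam n) * (r * 2))) *
      ENNReal.ofReal (2 * r) ^ (n - blockLen lam n - 1))) ^ k with hC
  have hCtop : C ≠ ⊤ := by rw [hC]; finiteness
  have hlim : Tendsto (fun δ : ℝ => C * ENNReal.ofReal (δ ^ ((k : ℝ) - s))) (𝓝[>] 0) (𝓝 0) := by
    have h1 : Tendsto (fun δ : ℝ => δ ^ ((k : ℝ) - s)) (𝓝[>] 0) (𝓝 0) := by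
      have := (Real.continuousAt_rpow_const 0 ((k : ℝ) - s) (Or.inr (by linarith))).tendsto
      rw [Real.zero_rpow (by linarith)] at this
      exact this.mono_left nhdsWithin_le_nhds
    simpa using ENNReal.Tendsto.const_mul (ENNReal.tendsto_ofReal h1) (Or.inr hCtop)
  refine le_antisymm (le_of_forall_gt fun b hb => ?_) zero_le
  obtain ⟨δ, ⟨⟨m, c, hcov, hm⟩, hδlt⟩, hδ⟩ := ((hK.and_eventually
    (hlim.eventually_lt_const hb)).and_eventually self_mem_nhdsWithin).exists
  refine lt_of_le_of_lt ?_ hδlt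
  have hsub : collisionMatrices B K x r d j ⊆
      ⋃ i, collisionMatrices B (K ∩ Metric.closedBall (c i) δ) x r d j := by
    rintro A ⟨hA, x', hx', h⟩
    obtain ⟨i, hi⟩ := Set.mem_iUnion.1 (hcov hx')
    exact Set.mem_iUnion.2 ⟨i, hA, x', ⟨hx', hi⟩, h⟩
  have hball (i : Fin m) : volume (collisionMatrices B (K ∩ Metric.closedBall (c i) δ) x r d j) ≤
      C * ENNReal.ofReal (δ ^ k) := by
    refine (volume_collisionMatrices_closedBall_le hB hr hd j K (c i) x δ).trans_eq ?_
    rw [hC, ENNReal.ofReal_pow hδ.le, ← mul_pow]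
    congr 1
    rw [← mul_assoc r, ← mul_assoc (Fintype.card (BlockIdx lam n) : ℝ), ← mul_assoc (2 : ℝ),
      ENNReal.ofReal_mul (by positivity)]
    ring
  calc volume (collisionMatrices B K x r d j)
      ≤ ∑ i, volume (collisionMatrices B (K ∩ Metric.closedBall (c i) δ) x r d j) :=
        (measure_mono hsub).trans (measure_iUnion_fintype_le _ _)
    _ ≤ m * (C * ENNReal.ofReal (δ ^ k)) := by
        refine (Finset.sum_le_sum fun i _ => hball i).trans_eq ?_
        simp
    _ ≤ ENNReal.ofReal (δ ^ (-s)) * (C * ENNReal.ofReal (δ ^ k)) := by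
        gcongr
        rw [← ENNReal.ofReal_natCast]
        exact ENNReal.ofReal_le_ofReal hm
    _ = C * ENNReal.ofReal (δ ^ ((k : ℝ) - s)) := by
        rw [mul_left_comm, ← ENNReal.ofReal_mul (by positivity), ← Real.rpow_natCast,
          ← Real.rpow_add hδ]
        congr 3; ring

/-! ### Ambiguity and decoding -/

/-- The pairs `(A, x)` with `x ∈ K` such that the measurement `[A B] x` does not determine `x`
within `K`. -/
def ambiguousPairs {lam : ℝ} {n k : ℕ} (B : Matrix (Fin k) (Fin (blockLen lam n)) ℝ)
    (K : Set (EuclideanSpace ℝ (BlockIdx lam n))) :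
    Set ((Fin k → Fin (n - blockLen lam n) → ℝ) × EuclideanSpace ℝ (BlockIdx lam n)) :=
  {q | q.2 ∈ K ∧ ∃ x' ∈ K, x' ≠ q.2 ∧ measurement q.1 B x' = measurement q.1 B q.2}

/-- Replacing `x' ≠ x` by distance at least `1 / (m + 1)` makes the condition closed, and projection
along the compact `K` preserves closedness. -/
theorem measurableSet_ambiguousPairs {lam : ℝ} {n k : ℕ}
    (B : Matrix (Fin k) (Fin (blockLen lam n)) ℝ)
    {K : Set (EuclideanSpace ℝ (BlockIdx lam n))} (hK : IsCompact K) :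
    MeasurableSet (ambiguousPairs B K) := by
  have : CompactSpace K := isCompact_iff_compactSpace.1 hK
  have heq : ambiguousPairs B K = {q | q.2 ∈ K} ∩ ⋃ m : ℕ, Prod.fst ''
      {t : ((Fin k → Fin (n - blockLen lam n) → ℝ) × EuclideanSpace ℝ (BlockIdx lam n)) × K |
        1 / ((m : ℝ) + 1) ≤ dist (t.2 : EuclideanSpace ℝ (BlockIdx lam n)) t.1.2 ∧
          measurement t.1.1 B t.2 = measurement t.1.1 B t.1.2} := by
    ext q
    simp only [ambiguousPairs, Set.mem_ofPred_eq, Set.mem_inter_iff, Set.mem_iUnion, Set.mem_image]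
    refine and_congr_right fun _ => ⟨?_, ?_⟩
    · rintro ⟨x', hx', hne, h⟩
      obtain ⟨m, hm⟩ := exists_nat_one_div_lt (dist_pos.2 hne)
      exact ⟨m, (q, ⟨x', hx'⟩), ⟨hm.le, h⟩, rfl⟩
    · rintro ⟨m, ⟨q', x'⟩, ⟨hm, h⟩, rfl⟩
      exact ⟨x', x'.2, dist_pos.1 (lt_of_lt_of_le (by positivity) hm), h⟩
  rw [heq]
  refine (hK.isClosed.preimage continuous_snd).measurableSet.inter
    (MeasurableSet.iUnion fun m => IsClosed.measurableSet (isClosedMap_fst_of_compactSpace _ ?_))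
  have hcont := continuous_measurement_uncurry (k := k) B
  refine (isClosed_le continuous_const
    ((continuous_subtype_val.comp continuous_snd).dist
      (continuous_snd.comp continuous_fst))).inter (isClosed_eq ?_ ?_)
  · exact hcont.comp (f := fun t : ((Fin k → Fin (n - blockLen lam n) → ℝ) ×
      EuclideanSpace ℝ (BlockIdx lam n)) × K => (t.1.1, (t.2 : EuclideanSpace ℝ (BlockIdx lam n))))
      (by fun_prop)
  · exact hcont.comp continuous_fst

/-- If the first blocks agree, `B` maps the second blocks to the same vector, and full column rank
makes them equal. -/
theorem exists_inl_ne_of_measurement_eq {lam : ℝ} {n k : ℕ}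
    {A : Fin k → Fin (n - blockLen lam n) → ℝ} {B : Matrix (Fin k) (Fin (blockLen lam n)) ℝ}
    (hB : B.rank = blockLen lam n) {x y : EuclideanSpace ℝ (BlockIdx lam n)} (hne : x ≠ y)
    (h : measurement A B x = measurement A B y) : ∃ j, x (Sum.inl j) ≠ y (Sum.inl j) := by
  by_contra! hinl
  have hinj : Function.Injective B.mulVec := by
    rw [Matrix.mulVec_injective_iff, linearIndependent_iff_card_eq_finrank_span,
      Set.finrank, ← Matrix.rank_eq_finrank_span_cols, hB, Fintype.card_fin]
  have hinr : (fun l => x (Sum.inr l)) = fun l => y (Sum.inr l) := by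
    refine hinj (funext fun i => ?_)
    have hi := congrArg (fun v : EuclideanSpace ℝ (Fin k) => v i) h
    simpa [measurement_apply, hinl, Matrix.mulVec, dotProduct] using hi
  refine hne (PiLp.ext ?_)
  rintro (j | l)
  · exact hinl j
  · exact congrFun hinr l

theorem ae_notMem_ambiguousPairs {lam : ℝ} {n k : ℕ}
    {B : Matrix (Fin k) (Fin (blockLen lam n)) ℝ} (hB : B.rank = blockLen lam n)
    {K : Set (EuclideanSpace ℝ (BlockIdx lam n))} {s : ℝ} (hK : FrequentlyCoveredBy K s)
    (hs : s < k) (x : EuclideanSpace ℝ (BlockIdx lam n)) :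
    ∀ᵐ A : Fin k → Fin (n - blockLen lam n) → ℝ ∂volume, (A, x) ∉ ambiguousPairs B K := by
  obtain ⟨r₀, hr₀⟩ : ∃ r₀ : ℕ, ∀ i l, |B i l| ≤ r₀ := by
    obtain ⟨M, hM⟩ := (Set.finite_range fun p : Fin k × Fin (blockLen lam n) =>
      |B p.1 p.2|).bddAbove
    obtain ⟨r₀, hr₀⟩ := exists_nat_ge M
    exact ⟨r₀, fun i l => (hM ⟨(i, l), rfl⟩).trans hr₀⟩
  -- Countably many null sets suffice; the bound `r₀ + r` dominates the entries of `A` and `B`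
  -- together.
  have hnull : ∀ᵐ A : Fin k → Fin (n - blockLen lam n) → ℝ ∂volume, ∀ (r m : ℕ)
      (j : Fin (n - blockLen lam n)),
      A ∉ collisionMatrices B K x ((r₀ + r : ℕ) : ℝ) (1 / ((m : ℝ) + 1)) j := by
    simp only [ae_all_iff]
    intro r m j
    refine measure_eq_zero_iff_ae_notMem.1 (volume_collisionMatrices_eq_zero
      (fun i l => (hr₀ i l).trans ?_) (by positivity) (by positivity) j hK hs x)
    exact_mod_cast Nat.le_add_right r₀ r
  filter_upwards [hnull] with A hA
  rintro ⟨-, x', hx', hne, heq⟩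
  obtain ⟨j, hj⟩ := exists_inl_ne_of_measurement_eq hB hne heq
  obtain ⟨m, hm⟩ := exists_nat_one_div_lt (abs_pos.2 (sub_ne_zero.2 hj))
  obtain ⟨r, hr⟩ : ∃ r : ℕ, ∀ i l, |A i l| ≤ r := by
    obtain ⟨M, hM⟩ := (Set.finite_range fun p : Fin k × Fin (n - blockLen lam n) =>
      |A p.1 p.2|).bddAbove
    obtain ⟨r, hr⟩ := exists_nat_ge M
    exact ⟨r, fun i l => (hM ⟨(i, l), rfl⟩).trans hr⟩
  refine hA r m j ⟨fun i l => (hr i l).trans ?_, x', hx', hm.le, heq⟩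
  exact_mod_cast Nat.le_add_left r r₀

theorem exists_measurable_separator {lam : ℝ} {n k : ℕ}
    (A : Fin k → Fin (n - blockLen lam n) → ℝ) (B : Matrix (Fin k) (Fin (blockLen lam n)) ℝ)
    {K : Set (EuclideanSpace ℝ (BlockIdx lam n))} (hK : IsCompact K) :
    ∃ g : EuclideanSpace ℝ (Fin k) → EuclideanSpace ℝ (BlockIdx lam n), Measurable g ∧
      ∀ x ∈ K, (A, x) ∉ ambiguousPairs B K → g (measurement A B x) = x := by
  set G : Set (EuclideanSpace ℝ (BlockIdx lam n)) := K ∩ {x | (A, x) ∉ ambiguousPairs B K} with hG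
  have hGm : MeasurableSet G := hK.isClosed.measurableSet.inter
    (measurable_prodMk_left (measurableSet_ambiguousPairs B hK)).compl
  have hcont : Continuous (measurement A B) :=
    (continuous_measurement_uncurry B).comp (continuous_const.prodMk continuous_id)
  have hinj : Set.InjOn (measurement A B) G := by
    rintro x ⟨hx, hxA⟩ y ⟨hy, -⟩ hxy
    by_contra hne
    exact hxA ⟨hx, y, hy, Ne.symm hne, hxy.symm⟩
  -- By Lusin–Souslin, a continuous injection on a Borel set has a Borel inverse, which extends to
  -- the whole space.
  obtain ⟨g, hg, hgG⟩ := (hcont.continuousOn.measurableEmbedding hGm hinj).exists_measurable_extend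
    (measurable_subtype_coe (p := (· ∈ G))) fun _ => ⟨0⟩
  exact ⟨g, hg, fun x hx hxA => congrFun hgG ⟨x, hx, hxA⟩⟩

theorem measurable_sourceVector {Ω : Type*} [MeasurableSpace Ω] {Y Z : ℕ → Ω → ℝ}
    (hY : ∀ i, Measurable (Y i)) (hZ : ∀ i, Measurable (Z i)) (lam : ℝ) (n : ℕ) :
    Measurable (sourceVector Y Z lam n) := by
  refine (WithLp.measurable_toLp 2 _).comp (measurable_pi_lambda _ ?_)
  rintro (i | i)
  · exact hY i
  · exact hZ i

theorem ae_exists_separator {Ω : Type*} [MeasurableSpace Ω] (P : Measure Ω)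
    [IsProbabilityMeasure P] {lam : ℝ} {n k : ℕ}
    {X : Ω → EuclideanSpace ℝ (BlockIdx lam n)} (hX : Measurable X)
    {B : Matrix (Fin k) (Fin (blockLen lam n)) ℝ} (hB : B.rank = blockLen lam n)
    {K : Set (EuclideanSpace ℝ (BlockIdx lam n))} (hKc : IsCompact K) {s : ℝ}
    (hK : FrequentlyCoveredBy K s) (hs : s < k) :
    ∀ᵐ A : Fin k → Fin (n - blockLen lam n) → ℝ ∂volume,
      ∃ g : EuclideanSpace ℝ (Fin k) → EuclideanSpace ℝ (BlockIdx lam n), Measurable g ∧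
        P.real {ω | g (measurement A B (X ω)) ≠ X ω} ≤ 1 - P.real {ω | X ω ∈ K} := by
  have hae : ∀ᵐ A : Fin k → Fin (n - blockLen lam n) → ℝ ∂volume, ∀ᵐ ω ∂P,
      (A, X ω) ∉ ambiguousPairs B K := by
    -- Fubini turns a null set of `A` for each `x` into a null set of outcomes for almost every `A`.
    rw [Measure.ae_ae_comm
      (p := fun (A : Fin k → Fin (n - blockLen lam n) → ℝ) ω => (A, X ω) ∉ ambiguousPairs B K)]
    · exact ae_of_all _ fun ω => ae_notMem_ambiguousPairs hB hK hs (X ω)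
    · exact ((measurable_fst.prodMk (hX.comp measurable_snd))
        (measurableSet_ambiguousPairs B hKc)).compl
  filter_upwards [hae] with A hA
  obtain ⟨g, hg, hgK⟩ := exists_measurable_separator A B hKc
  refine ⟨g, hg, ?_⟩
  change _ ≤ 1 - P.real (X ⁻¹' K)
  rw [← probReal_compl_eq_one_sub (hX hKc.isClosed.measurableSet)]
  refine ENNReal.toReal_mono (measure_ne_top _ _) (measure_mono_ae ?_)
  filter_upwards [hA] with ω hω hne hωK
  exact hne (hgK _ hωK hω)

theorem theorem1 {Ω : Type*} [MeasurableSpace Ω] (P : Measure Ω) [IsProbabilityMeasure P]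
    (Y Z : ℕ → Ω → ℝ) (hY : ∀ i, Measurable (Y i)) (hZ : ∀ i, Measurable (Z i))
    (lam : ℝ) (hlam : lam ∈ Set.Icc (0 : ℝ) 1) (ε : ℝ) (hε : 0 < ε)
    (R : ℝ) (hR : lowerCompressionRate P Y Z lam ε < (R : EReal)) :
    ∃ N : ℕ, ∀ n : ℕ, N ≤ n → ∀ k : ℕ, k = ⌊R * n⌋₊ → blockLen lam n ≤ k →
      ∀ B : Matrix (Fin k) (Fin (blockLen lam n)) ℝ, B.rank = blockLen lam n →
        ∀ᵐ A : Fin k → Fin (n - blockLen lam n) → ℝ ∂volume,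
          ∃ g : EuclideanSpace ℝ (Fin k) → EuclideanSpace ℝ (BlockIdx lam n),
            Measurable g ∧
            P.real {ω | g (measurement A B (sourceVector Y Z lam n ω)) ≠
              sourceVector Y Z lam n ω} ≤ ε := by
  obtain ⟨R', hR', hR'R⟩ := EReal.exists_between_coe_real hR
  rw [EReal.coe_lt_coe_iff] at hR'R
  obtain ⟨N₁, hN₁⟩ := eventually_atTop.1 (eventually_lt_of_limsup_lt hR' (by isBoundedDefault))
  -- This makes `n * (R - R') ≥ 1`, which absorbs the loss from the floor and gives `R' * n < k`.
  obtain ⟨N₂, hN₂⟩ := exists_nat_ge (1 / (R - R'))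
  refine ⟨max N₁ (max N₂ 1), fun n hn k hk _ B hB => ?_⟩
  simp only [max_le_iff] at hn
  obtain ⟨hn₁, hn₂, hn1⟩ := hn
  obtain ⟨_, ⟨S, hSne, hSb, hSm, hSP, rfl⟩, hSlt⟩ := sInf_lt_iff.1 (hN₁ n hn₁)
  have hn0 : (0 : EReal) < (n : EReal) := by exact_mod_cast hn1
  have hdim : lowerMinkowskiDim S < ((R' * n : ℝ) : EReal) := by
    rw [EReal.div_lt_iff hn0 (EReal.natCast_ne_top n)] at hSlt
    exact_mod_cast hSlt
  have hs : R' * n < k := by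
    have h1 : R * n - 1 < k := hk ▸ Nat.sub_one_lt_floor (R * n)
    have h2 : 1 ≤ (n : ℝ) * (R - R') := by
      rw [← div_le_iff₀ (sub_pos.2 hR'R)]
      exact hN₂.trans (by exact_mod_cast hn₂)
    nlinarith
  have hcov := (frequentlyCoveredBy_of_lowerMinkowskiDim_lt hSne
    (hSb.isCompact_closure.totallyBounded.subset subset_closure) hdim).closure
  filter_upwards [ae_exists_separator P (measurable_sourceVector hY hZ lam n) hB
    hSb.isCompact_closure hcov hs] with A ⟨g, hg, hgP⟩
  refine ⟨g, hg, hgP.trans ?_⟩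
  have hmono : P.real {ω | sourceVector Y Z lam n ω ∈ S} ≤
      P.real {ω | sourceVector Y Z lam n ω ∈ closure S} :=
    measureReal_mono fun ω hω => subset_closure hω
  linarith
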